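/- Let $H\in\mathbb R^{d\times N}$, let $\alpha>0$, $\rho,c\in(0,1)$ and $\bar\eta>0$, and assume $\operatorname{rank}(H)+N\le d$. On the scaled Stiefel manifold $\mathrm{St}(d,N,\alpha)=\{V\in\mathbb R^{d\times N}: V^\top V=\alpha I\}$, with tangent projection $\mathrm{Proj}_{T_V}(U)=U-V\frac{V^\top U+U^\top V}{2\alpha}$, consider the objective $\ell(V)=-\log\det\big((H+V)^\top(H+V)\big)$, with $\ell(V)=+\infty$ when $H+V$ is rank-deficient. Write $\nabla\ell(V)=-2(H+V)[(H+V)^\top(H+V)]^{-1}$ for its Euclidean gradient, $\mathrm{grad}\,\ell(V)=\mathrm{Proj}_{T_V}(\nabla\ell(V))$ for its Riemannian gradient, and $\mathrm R_V(U)=\sqrt\alpha\,(V+U)(\alpha I+U^\top U)^{-1/2}$ for the polar retraction. Riemannian gradient descent with Armijo backtracking runs as follows. Initialization: take a singular value decomposition $H=Q\Sigma W^\top$, with the singular values in decreasing order, select $N$ distinct columns of $Q$ among its last $d-\operatorname{rank}(H)$ columns, and let $V_0$ be the matrix of these columns multiplied by $\sqrt\alpha$. Iteration: put $S_k=-\mathrm{grad}\,\ell(V_k)$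 and $V_{k+1}=\mathrm R_{V_k}(\eta_k S_k)$, where $\eta_k$ is the first of the stepsizes $\bar\eta,\rho\bar\eta,\rho^2\bar\eta,\dots$ that satisfies $\ell(V_k)-\ell(\mathrm R_{V_k}(\eta_k S_k))\ge c\,\eta_k\|S_k\|_F^2$. Let $\mathcal C=\{V\in\mathrm{St}(d,N,\alpha):\ell(V)\le\ell(V_0)\}$ and $\bar D=\max_{V\in\mathcal C}\|\nabla\ell(V)\|_F$, and suppose that $\bar\eta<\sqrt\alpha/\bar D$. Then from every such $V_0$ the algorithm is well defined (each line search terminates, so it generates an infinite sequence $V_0,V_1,V_2,\dots$), and $\min_{0\le k\le K}\|\mathrm{grad}\,\ell(V_k)\|_F^2=O(1/K)$: there is a constant $M$, depending only on $H,\alpha,\rho,c,\bar\eta$, such that for all $K\ge1$ $$\min_{0\le k\le K}\|\mathrm{grad}\,\ell(V_k)\|_F^2\le\frac MK .$$ -/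

import Mathlib

open scoped Matrix

namespace ScaledStiefel

/-- The scaled Stiefel manifold `St(d, N, α) = {V : VᵀV = α I}`. -/
def stiefel (d N : ℕ) (α : ℝ) : Set (Matrix (Fin d) (Fin N) ℝ) :=
  {V | Vᵀ * V = α • (1 : Matrix (Fin N) (Fin N) ℝ)}

section Polar

open scoped MatrixOrder

/-- The polar retraction `R_V(U) = √α (V + U) (α I + UᵀU)^{-1/2}`. The matrix `α I + UᵀU` is
positive definite for `α > 0`, and `CFC.sqrt` is its positive definite square root. -/
noncomputable def polarRetraction {d N : ℕ} (α : ℝ) (V U : Matrix (Fin d) (Fin N) ℝ) :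
    Matrix (Fin d) (Fin N) ℝ :=
  √α • ((V + U) * (CFC.sqrt (α • (1 : Matrix (Fin N) (Fin N) ℝ) + Uᵀ * U))⁻¹)

end Polar

/-- The objective `ℓ(V) = -log det((H+V)ᵀ(H+V))`, with the value `+∞` where `H + V` is
rank-deficient (the Gram determinant is never negative). -/
noncomputable def objective {d N : ℕ} (H V : Matrix (Fin d) (Fin N) ℝ) : EReal :=
  if 0 < ((H + V)ᵀ * (H + V)).det then
    ((-Real.log ((H + V)ᵀ * (H + V)).det : ℝ) : EReal)
  else ⊤

/-- The Euclidean gradient `∇ℓ(V) = -2 (H+V) [(H+V)ᵀ(H+V)]⁻¹`. -/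
noncomputable def euclideanGrad {d N : ℕ} (H V : Matrix (Fin d) (Fin N) ℝ) :
    Matrix (Fin d) (Fin N) ℝ :=
  (-2 : ℝ) • ((H + V) * ((H + V)ᵀ * (H + V))⁻¹)

/-- The orthogonal projection `U ↦ U - V (VᵀU + UᵀV) / (2α)` onto the tangent space at `V`. -/
noncomputable def tangentProj {d N : ℕ} (α : ℝ) (V U : Matrix (Fin d) (Fin N) ℝ) :
    Matrix (Fin d) (Fin N) ℝ :=
  U - (1 / (2 * α)) • (V * (Vᵀ * U + Uᵀ * V))

/-- The Riemannian gradient `grad ℓ(V) = Proj_{T_V}(∇ℓ(V))`. -/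
noncomputable def riemannianGrad {d N : ℕ} (H : Matrix (Fin d) (Fin N) ℝ) (α : ℝ)
    (V : Matrix (Fin d) (Fin N) ℝ) : Matrix (Fin d) (Fin N) ℝ :=
  tangentProj α V (euclideanGrad H V)

/-- `H = Q Σ Wᵀ` is a (full) singular value decomposition: `Q`, `W` are orthogonal and `Σ` is the
rectangular diagonal matrix of the singular values `σ`, in decreasing order. -/
structure IsSVD {d N : ℕ} (H : Matrix (Fin d) (Fin N) ℝ) (Q : Matrix (Fin d) (Fin d) ℝ)
    (σ : Fin N → ℝ) (W : Matrix (Fin N) (Fin N) ℝ) : Prop where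
  left_orthogonal : Q ∈ Matrix.orthogonalGroup (Fin d) ℝ
  right_orthogonal : W ∈ Matrix.orthogonalGroup (Fin N) ℝ
  nonneg : ∀ j, 0 ≤ σ j
  antitone : Antitone σ
  pos_iff : ∀ j, 0 < σ j ↔ (j : ℕ) < H.rank
  eq_mul : H =
    Q * (Matrix.of fun (i : Fin d) (j : Fin N) => if (i : ℕ) = (j : ℕ) then σ j else 0) * Wᵀ

/-- The possible outputs of the initialization: take an SVD `H = Q Σ Wᵀ`, choose `N` distinct
columns of `Q` among the last `d - rank H` ones, and scale them by `√α`. -/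
def IsInitialization {d N : ℕ} (H : Matrix (Fin d) (Fin N) ℝ) (α : ℝ)
    (V₀ : Matrix (Fin d) (Fin N) ℝ) : Prop :=
  ∃ (Q : Matrix (Fin d) (Fin d) ℝ) (σ : Fin N → ℝ) (W : Matrix (Fin N) (Fin N) ℝ),
    IsSVD H Q σ W ∧
    ∃ s : Fin N → Fin d, Function.Injective s ∧ (∀ j, H.rank ≤ (s j : ℕ)) ∧
      V₀ = √α • Q.submatrix id s

/-- The sublevel set `𝒞 = {V ∈ St(d, N, α) : ℓ(V) ≤ ℓ(V₀)}`. -/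
def sublevel {d N : ℕ} (H : Matrix (Fin d) (Fin N) ℝ) (α : ℝ)
    (V₀ : Matrix (Fin d) (Fin N) ℝ) : Set (Matrix (Fin d) (Fin N) ℝ) :=
  {V | V ∈ stiefel d N α ∧ objective H V ≤ objective H V₀}

end ScaledStiefel

open scoped Matrix.Norms.Frobenius

namespace ScaledStiefel

/-- `D̄ = max_{V ∈ 𝒞} ‖∇ℓ(V)‖_F` (Frobenius norm). -/
noncomputable def gradBound {d N : ℕ} (H : Matrix (Fin d) (Fin N) ℝ) (α : ℝ)
    (V₀ : Matrix (Fin d) (Fin N) ℝ) : ℝ :=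
  sSup ((fun V => ‖euclideanGrad H V‖) '' sublevel H α V₀)

/-- The trial point `R_V(η S)` with `S = -grad ℓ(V)`. -/
noncomputable def trialPoint {d N : ℕ} (H : Matrix (Fin d) (Fin N) ℝ) (α : ℝ)
    (V : Matrix (Fin d) (Fin N) ℝ) (η : ℝ) : Matrix (Fin d) (Fin N) ℝ :=
  polarRetraction α V (η • (-riemannianGrad H α V))

/-- The sufficient decrease test `ℓ(V) - ℓ(R_V(η S)) ≥ c η ‖S‖_F²`, in the extended reals. It
fails at a trial point of infinite objective value, since `x - ⊤ = ⊥`. -/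
def Armijo {d N : ℕ} (H : Matrix (Fin d) (Fin N) ℝ) (α c : ℝ)
    (V : Matrix (Fin d) (Fin N) ℝ) (η : ℝ) : Prop :=
  ((c * η * ‖-riemannianGrad H α V‖ ^ 2 : ℝ) : EReal) ≤
    objective H V - objective H (trialPoint H α V η)

/-- `V'` is the result of the backtracking line search at `V`: the stepsizes `η̄, ρ η̄, ρ² η̄, …`
are tried in turn, and the first one that passes the test is taken. -/
def IsLineSearchStep {d N : ℕ} (H : Matrix (Fin d) (Fin N) ℝ) (α ρ c ηbar : ℝ)
    (V V' : Matrix (Fin d) (Fin N) ℝ) : Prop :=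
  ∃ j : ℕ, Armijo H α c V (ηbar * ρ ^ j) ∧ (∀ i < j, ¬ Armijo H α c V (ηbar * ρ ^ i)) ∧
    V' = trialPoint H α V (ηbar * ρ ^ j)

/-- `V 0, V 1, …` is a sequence generated by Riemannian gradient descent with line search. -/
structure IsRGDSequence {d N : ℕ} (H : Matrix (Fin d) (Fin N) ℝ) (α ρ c ηbar : ℝ)
    (V : ℕ → Matrix (Fin d) (Fin N) ℝ) : Prop where
  init : IsInitialization H α (V 0)
  step : ∀ k, IsLineSearchStep H α ρ c ηbar (V k) (V (k + 1))

end ScaledStiefel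

/-! ### Estimates for `log det` and for matrix inverses -/

namespace ScaledStiefel

/-! The initial columns are orthogonal to the range of `H`, so the Gram matrix at any initialization
is `HᵀH + αI`, whose determinant `δ > 0` does not depend on the choice made. Accepted steps never
increase `ℓ`, so all iterates stay where the Gram determinant is at least `δ`. There the inverse
Gram matrix is uniformly bounded, and since the retraction has quadratic error, `ℓ` obeys a descent
inequality with uniform constants (`exists_descent`). Hence every stepsize below some uniform `t`
passes the test (`exists_armijo_of_le`): backtracking terminates with a step at least `min ηbar (ρ *
t)`, and each iteration lowers `ℓ` by a fixed multiple of the squared gradient norm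
(`IsLineSearchStep.decrease`). As `ℓ` is bounded below (`neg_log_det_gram_ge`), telescoping gives
the rate. -/

theorem frobenius_norm_sq {m n : ℕ} (A : Matrix (Fin m) (Fin n) ℝ) :
    ‖A‖ ^ 2 = (Aᵀ * A).trace := by
  have h0 : 0 ≤ ∑ i, ∑ j, ‖A i j‖ ^ (2 : ℝ) := by positivity
  rw [Matrix.frobenius_norm_def, ← Real.sqrt_eq_rpow, Real.sq_sqrt h0, Finset.sum_comm]
  simp [Matrix.trace, Matrix.mul_apply, sq]

theorem abs_trace_le {n : ℕ} (A : Matrix (Fin n) (Fin n) ℝ) : |A.trace| ≤ n * ‖A‖ := by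
  have h (i : Fin n) : |A i i| ≤ ‖A‖ := by
    apply abs_le_of_sq_le_sq _ (norm_nonneg A)
    rw [frobenius_norm_sq]
    simp only [Matrix.trace, Matrix.diag_apply, Matrix.mul_apply, Matrix.transpose_apply, ← sq]
    refine le_trans ?_ (Finset.single_le_sum (fun j _ => by positivity) (Finset.mem_univ i))
    exact Finset.single_le_sum (f := fun k => A k i ^ 2) (fun k _ => by positivity)
      (Finset.mem_univ i)
  calc |A.trace| ≤ ∑ i, |A i i| := Finset.abs_sum_le_sum_abs _ _
    _ ≤ ∑ _i : Fin n, ‖A‖ := Finset.sum_le_sum fun i _ => h i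
    _ = n * ‖A‖ := by simp

section Order
open scoped MatrixOrder

/-- A positive semidefinite matrix has a positive semidefinite square root. -/
theorem exists_posSemidef_mul_self_eq {n : ℕ} {A : Matrix (Fin n) (Fin n) ℝ}
    (hA : A.PosSemidef) : ∃ S : Matrix (Fin n) (Fin n) ℝ, S.PosSemidef ∧ S * S = A :=
  ⟨CFC.sqrt A, Matrix.nonneg_iff_posSemidef.mp (CFC.sqrt_nonneg A), CFC.sqrt_mul_sqrt_self A hA.nonneg⟩

theorem exists_polarRetraction_eq {d N : ℕ} {α : ℝ} (hα : 0 < α)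
    (V U : Matrix (Fin d) (Fin N) ℝ) :
    ∃ P : Matrix (Fin N) (Fin N) ℝ, P.PosSemidef ∧ P * P = α • 1 + Uᵀ * U ∧
      polarRetraction α V U = √α • ((V + U) * P⁻¹) := by
  have hU : (Uᵀ * U).PosSemidef := by
    simpa using Matrix.posSemidef_conjTranspose_mul_self U
  exact ⟨_, Matrix.nonneg_iff_posSemidef.mp (CFC.sqrt_nonneg _),
    CFC.sqrt_mul_sqrt_self _ ((Matrix.PosSemidef.one.smul hα.le).add hU).nonneg, rfl⟩

end Order

/-- Sum `log x ≤ x - 1` over the eigenvalues. This yields both the concavity of `log det` and the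
lower bound on the objective. -/
theorem log_det_le_trace_sub {n : ℕ} {A : Matrix (Fin n) (Fin n) ℝ} (hA : A.PosSemidef)
    (hdet : 0 < A.det) : Real.log A.det ≤ A.trace - n := by
  have hH := hA.isHermitian
  have hd : A.det = ∏ i, hH.eigenvalues i := by simpa using hH.det_eq_prod_eigenvalues
  have ht : A.trace = ∑ i, hH.eigenvalues i := by simpa using hH.trace_eq_sum_eigenvalues
  have hpos (i) : 0 < hH.eigenvalues i := by
    refine lt_of_le_of_ne (hA.eigenvalues_nonneg i) fun h => hdet.ne' ?_
    rw [hd]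
    exact Finset.prod_eq_zero (Finset.mem_univ i) h.symm
  rw [hd, ht, Real.log_prod (fun i _ => (hpos i).ne')]
  calc ∑ i, Real.log (hH.eigenvalues i) ≤ ∑ i, (hH.eigenvalues i - 1) :=
        Finset.sum_le_sum fun i _ => Real.log_le_sub_one_of_pos (hpos i)
    _ = _ := by simp

/-- Concavity of `log det` on the positive definite cone. -/
theorem log_det_sub_log_det_le {n : ℕ} {A B : Matrix (Fin n) (Fin n) ℝ} (hA : A.PosSemidef)
    (hA' : 0 < A.det) (hB : B.PosSemidef) (hB' : 0 < B.det) :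
    Real.log A.det - Real.log B.det ≤ (B⁻¹ * (A - B)).trace := by
  -- Congruence by `S = B^{-1/2}` reduces to the case `B = 1`, which is `log_det_le_trace_sub`.
  obtain ⟨S, hS, hSS⟩ := exists_posSemidef_mul_self_eq hB.inv
  have hSt : Sᵀ = S := by simpa using hS.isHermitian.eq
  have hM : (S * A * S).PosSemidef := by
    simpa [hSt] using hA.mul_mul_conjTranspose_same S
  have hdet : (S * A * S).det = A.det / B.det := by
    have h : S.det * S.det = B.det⁻¹ := by
      rw [← Matrix.det_mul, hSS, Matrix.det_nonsing_inv, Ring.inverse_eq_inv']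
    rw [Matrix.det_mul, Matrix.det_mul, mul_right_comm, h]
    field_simp
  have htr : (S * A * S).trace = (B⁻¹ * A).trace := by
    rw [Matrix.trace_mul_comm, ← mul_assoc, hSS]
  have h := log_det_le_trace_sub hM (by rw [hdet]; positivity)
  rw [hdet, htr, Real.log_div hA'.ne' hB'.ne'] at h
  rw [mul_sub, Matrix.nonsing_inv_mul B hB'.ne'.isUnit, Matrix.trace_sub, Matrix.trace_one]
  simpa using h

/-- Write the inverse as adjugate over determinant; the adjugate is continuous, hence bounded on the
compact ball. -/
theorem exists_norm_inv_le (n : ℕ) (R δ : ℝ) (hδ : 0 < δ) :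
    ∃ B : ℝ, 0 < B ∧ ∀ A : Matrix (Fin n) (Fin n) ℝ, ‖A‖ ≤ R → δ ≤ A.det → ‖A⁻¹‖ ≤ B := by
  have : ProperSpace (Matrix (Fin n) (Fin n) ℝ) := FiniteDimensional.proper ℝ _
  obtain ⟨C, hC⟩ := (isCompact_closedBall (0 : Matrix (Fin n) (Fin n) ℝ) R).exists_bound_of_continuousOn
    (f := fun A => A.adjugate) (continuous_id.matrix_adjugate).continuousOn
  refine ⟨δ⁻¹ * |C| + 1, by positivity, fun A hA hd => ?_⟩
  have hdp : 0 < A.det := hδ.trans_le hd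
  rw [Matrix.inv_def, Ring.inverse_eq_inv', norm_smul, Real.norm_of_nonneg (by positivity)]
  have h1 : A.det⁻¹ ≤ δ⁻¹ := by gcongr
  have h2 := (hC A (by simpa using hA)).trans (le_abs_self C)
  have := mul_le_mul h1 h2 (norm_nonneg _) (by positivity)
  linarith

/-- Inverses stay bounded under small perturbations. -/
theorem isUnit_det_add_and_norm_inv_le {n : ℕ} {A E : Matrix (Fin n) (Fin n) ℝ} {B : ℝ}
    (hA : IsUnit A.det) (hB : ‖A⁻¹‖ ≤ B) (hE : B * ‖E‖ ≤ 1 / 2) :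
    IsUnit (A + E).det ∧ ‖(A + E)⁻¹‖ ≤ 2 * B := by
  have hs : ‖A⁻¹ * E‖ ≤ 1 / 2 := by
    refine (norm_mul_le _ _).trans (le_trans ?_ hE)
    gcongr
  have hu : IsUnit (1 - -(A⁻¹ * E)) := by
    have : CompleteSpace (Matrix (Fin n) (Fin n) ℝ) := FiniteDimensional.complete ℝ _
    apply isUnit_one_sub_of_norm_lt_one
    rw [norm_neg]
    linarith
  have hAE : A + E = A * (1 - -(A⁻¹ * E)) := by
    rw [sub_neg_eq_add, mul_add, ← mul_assoc, Matrix.mul_nonsing_inv A hA]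
    simp
  have hdet : IsUnit (A + E).det := by
    rw [hAE, Matrix.det_mul]
    exact hA.mul ((Matrix.isUnit_iff_isUnit_det _).mp hu)
  refine ⟨hdet, ?_⟩
  have h : (A + E)⁻¹ = A⁻¹ - (A⁻¹ * E) * (A + E)⁻¹ := by
    have h1 : A⁻¹ * (A + E) * (A + E)⁻¹ = A⁻¹ := by
      rw [mul_assoc, Matrix.mul_nonsing_inv _ hdet, mul_one]
    rw [mul_add, Matrix.nonsing_inv_mul A hA, add_mul, one_mul] at h1
    exact eq_sub_of_add_eq h1
  have h2 : ‖(A + E)⁻¹‖ ≤ ‖A⁻¹‖ + ‖A⁻¹ * E‖ * ‖(A + E)⁻¹‖ := by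
    calc ‖(A + E)⁻¹‖ = ‖A⁻¹ - (A⁻¹ * E) * (A + E)⁻¹‖ := by rw [← h]
      _ ≤ ‖A⁻¹‖ + ‖(A⁻¹ * E) * (A + E)⁻¹‖ := norm_sub_le _ _
      _ ≤ _ := by gcongr; exact norm_mul_le _ _
  nlinarith [norm_nonneg ((A + E)⁻¹)]

/-- Second-order upper bound for `-log det`. -/
theorem neg_log_det_add_le {n : ℕ} {A E : Matrix (Fin n) (Fin n) ℝ} {B : ℝ}
    (hA : A.PosSemidef) (hA' : 0 < A.det) (hAE : (A + E).PosSemidef) (hB : ‖A⁻¹‖ ≤ B)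
    (hE : B * ‖E‖ ≤ 1 / 2) :
    0 < (A + E).det ∧ -Real.log (A + E).det ≤
      -Real.log A.det - (A⁻¹ * E).trace + 2 * n * B ^ 2 * ‖E‖ ^ 2 := by
  obtain ⟨hu, hn⟩ := isUnit_det_add_and_norm_inv_le hA'.ne'.isUnit hB hE
  have hB0 : 0 ≤ B := (norm_nonneg _).trans hB
  have hpos : 0 < (A + E).det := lt_of_le_of_ne hAE.det_nonneg hu.ne_zero.symm
  refine ⟨hpos, ?_⟩
  -- Concavity is used with the tangent at `A + E`, which bounds in the needed direction; trading
  -- `(A + E)⁻¹` for `A⁻¹` then costs only a term quadratic in `E`.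
  have h1 := log_det_sub_log_det_le hA hA' hAE hpos
  have h2 : (A + E)⁻¹ * (A - (A + E)) = -(A⁻¹ * E) + (A + E)⁻¹ * E * (A⁻¹ * E) := by
    have h3 : (A + E)⁻¹ * (A + E) * A⁻¹ = A⁻¹ := by
      rw [Matrix.nonsing_inv_mul _ hu, one_mul]
    rw [mul_add, add_mul, mul_assoc, Matrix.mul_nonsing_inv A hA'.ne'.isUnit, mul_one] at h3
    rw [sub_add_cancel_left, mul_neg]
    have h5 : A⁻¹ * E = (A + E)⁻¹ * E + (A + E)⁻¹ * E * (A⁻¹ * E) := by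
      nth_rewrite 1 [← h3]
      rw [add_mul, mul_assoc _ A⁻¹ E]
    nth_rewrite 1 [h5]
    abel
  have h4 : ((A + E)⁻¹ * E * (A⁻¹ * E)).trace ≤ 2 * n * B ^ 2 * ‖E‖ ^ 2 := by
    calc _ ≤ n * ‖(A + E)⁻¹ * E * (A⁻¹ * E)‖ := (le_abs_self _).trans (abs_trace_le _)
      _ ≤ n * (‖(A + E)⁻¹‖ * ‖E‖ * (‖A⁻¹‖ * ‖E‖)) := by
        gcongr
        refine (norm_mul_le _ _).trans ?_
        gcongr <;> exact norm_mul_le _ _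
      _ ≤ n * (2 * B * ‖E‖ * (B * ‖E‖)) := by gcongr
      _ = _ := by ring
  rw [h2, Matrix.trace_add, Matrix.trace_neg] at h1
  linarith

end ScaledStiefel

/-! ### Gram matrices, tangent vectors and the polar retraction -/

namespace ScaledStiefel

theorem gram_posSemidef {d N : ℕ} (A : Matrix (Fin d) (Fin N) ℝ) : (Aᵀ * A).PosSemidef := by
  simpa using Matrix.posSemidef_conjTranspose_mul_self A

theorem gram_inv_transpose {d N : ℕ} (A : Matrix (Fin d) (Fin N) ℝ) :
    ((Aᵀ * A)⁻¹)ᵀ = (Aᵀ * A)⁻¹ := by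
  simp [Matrix.transpose_nonsing_inv]

theorem norm_sq_of_mem_stiefel {d N : ℕ} {α : ℝ} {V : Matrix (Fin d) (Fin N) ℝ}
    (hV : V ∈ stiefel d N α) : ‖V‖ ^ 2 = α * N := by
  rw [frobenius_norm_sq, show Vᵀ * V = _ from hV]
  simp

theorem norm_of_mem_stiefel {d N : ℕ} {α : ℝ} {V : Matrix (Fin d) (Fin N) ℝ}
    (hV : V ∈ stiefel d N α) : ‖V‖ = √(α * N) := by
  rw [← norm_sq_of_mem_stiefel hV, Real.sqrt_sq (norm_nonneg V)]

theorem gram_eq {d N : ℕ} {α : ℝ} (H : Matrix (Fin d) (Fin N) ℝ) {V : Matrix (Fin d) (Fin N) ℝ}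
    (hV : V ∈ stiefel d N α) :
    (H + V)ᵀ * (H + V) = Hᵀ * H + α • 1 + (Hᵀ * V + Vᵀ * H) := by
  rw [← show Vᵀ * V = α • 1 from hV, Matrix.transpose_add, Matrix.add_mul, Matrix.mul_add,
    Matrix.mul_add]
  abel

/-- The quadratic terms `VᵀV` and `RᵀR` are both `αI` and cancel, so the Gram matrix is affine along
the manifold. -/
theorem gram_eq_add {d N : ℕ} {α : ℝ} (H : Matrix (Fin d) (Fin N) ℝ)
    {V R : Matrix (Fin d) (Fin N) ℝ} (hV : V ∈ stiefel d N α) (hR : R ∈ stiefel d N α) :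
    (H + R)ᵀ * (H + R) = (H + V)ᵀ * (H + V) + (Hᵀ * (R - V) + (R - V)ᵀ * H) := by
  rw [gram_eq H hV, gram_eq H hR, Matrix.mul_sub, Matrix.transpose_sub, Matrix.sub_mul]
  abel

theorem riemannianGrad_tangent {d N : ℕ} {α : ℝ} (hα : 0 < α) (H : Matrix (Fin d) (Fin N) ℝ)
    {V : Matrix (Fin d) (Fin N) ℝ} (hV : V ∈ stiefel d N α) :
    Vᵀ * riemannianGrad H α V + (riemannianGrad H α V)ᵀ * V = 0 := by
  have hV' : Vᵀ * V = α • 1 := hV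
  have h (U : Matrix (Fin d) (Fin N) ℝ) :
      Vᵀ * tangentProj α V U = (1 / 2 : ℝ) • (Vᵀ * U - Uᵀ * V) := by
    rw [tangentProj, Matrix.mul_sub, Matrix.mul_smul, ← Matrix.mul_assoc, hV', smul_mul_assoc,
      one_mul, smul_smul, show 1 / (2 * α) * α = 1 / 2 by field_simp]
    module
  have h' : (riemannianGrad H α V)ᵀ * V = (Vᵀ * riemannianGrad H α V)ᵀ := by simp
  rw [h', riemannianGrad, h]
  simp only [Matrix.transpose_smul, Matrix.transpose_sub, Matrix.transpose_mul,
    Matrix.transpose_transpose]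
  module

theorem trace_mul_skew_eq_zero {n : ℕ} {A S : Matrix (Fin n) (Fin n) ℝ} (hA : Aᵀ = A)
    (hS : Sᵀ = -S) : (A * S).trace = 0 := by
  have h : (A * S).trace = -(A * S).trace := by
    conv_lhs => rw [← Matrix.trace_transpose, Matrix.transpose_mul, hA, hS, Matrix.neg_mul,
      Matrix.trace_neg, Matrix.trace_mul_comm]
  linarith

/-- The part of the Euclidean gradient removed by the projection is `V` times a symmetric matrix,
and it pairs to zero with a tangent `S` because `VᵀS` is skew. -/
theorem norm_riemannianGrad_sq {d N : ℕ} {α : ℝ} (hα : 0 < α) (H : Matrix (Fin d) (Fin N) ℝ)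
    {V : Matrix (Fin d) (Fin N) ℝ} (hV : V ∈ stiefel d N α) :
    ‖riemannianGrad H α V‖ ^ 2 = ((euclideanGrad H V)ᵀ * riemannianGrad H α V).trace := by
  have ht := riemannianGrad_tangent hα H hV
  set g := euclideanGrad H V
  set S := riemannianGrad H α V with hS
  have hSt : Sᵀ = gᵀ - (1 / (2 * α)) • ((Vᵀ * g + gᵀ * V) * Vᵀ) := by
    rw [hS, riemannianGrad, tangentProj]
    simp only [Matrix.transpose_smul, Matrix.transpose_sub, Matrix.transpose_mul,
      Matrix.transpose_transpose, Matrix.transpose_add, g]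
    rw [add_comm (Vᵀ * euclideanGrad H V)]
  have h0 : ((Vᵀ * g + gᵀ * V) * (Vᵀ * S)).trace = 0 := by
    apply trace_mul_skew_eq_zero
    · simp [add_comm]
    · simpa using eq_neg_of_add_eq_zero_right ht
  rw [frobenius_norm_sq]
  nth_rewrite 1 [hSt]
  rw [Matrix.sub_mul, Matrix.trace_sub, Matrix.smul_mul, Matrix.trace_smul, Matrix.mul_assoc, h0]
  simp

/-- For tangent `U` the skew `VᵀU` drops out against the symmetric inverse, which leaves the
first-order term produced by `gram_eq_add`. -/
theorem trace_euclideanGrad_mul {d N : ℕ} (H : Matrix (Fin d) (Fin N) ℝ)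
    {V U : Matrix (Fin d) (Fin N) ℝ} (hU : Vᵀ * U + Uᵀ * V = 0) :
    ((euclideanGrad H V)ᵀ * U).trace =
      -2 * (((H + V)ᵀ * (H + V))⁻¹ * (Hᵀ * U)).trace := by
  have h0 : (((H + V)ᵀ * (H + V))⁻¹ * (Vᵀ * U)).trace = 0 := by
    apply trace_mul_skew_eq_zero (gram_inv_transpose _)
    simpa using eq_neg_of_add_eq_zero_right hU
  have h1 : (H + V)ᵀ * U = Hᵀ * U + Vᵀ * U := by rw [Matrix.transpose_add, Matrix.add_mul]
  rw [euclideanGrad, Matrix.transpose_smul, Matrix.transpose_mul, gram_inv_transpose,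
    Matrix.smul_mul, Matrix.trace_smul, Matrix.mul_assoc, h1, Matrix.mul_add _ (Hᵀ * U),
    Matrix.trace_add, h0]
  simp

theorem trace_mul_symm_part {d N : ℕ} {A : Matrix (Fin N) (Fin N) ℝ} (hA : Aᵀ = A)
    (H D : Matrix (Fin d) (Fin N) ℝ) :
    (A * (Hᵀ * D + Dᵀ * H)).trace = 2 * (A * (Hᵀ * D)).trace := by
  have h : (A * (Dᵀ * H)).trace = (A * (Hᵀ * D)).trace := by
    rw [← Matrix.trace_transpose, Matrix.transpose_mul, hA, Matrix.transpose_mul,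
      Matrix.transpose_transpose, Matrix.trace_mul_comm]
  rw [Matrix.mul_add, Matrix.trace_add, h]
  ring

/-- The polar retraction of a tangent vector stays on the manifold and is a first-order
retraction with a uniform quadratic error. -/
theorem polarRetraction_spec {d N : ℕ} {α : ℝ} (hα : 0 < α)
    {V U : Matrix (Fin d) (Fin N) ℝ} (hV : V ∈ stiefel d N α) (hU : Vᵀ * U + Uᵀ * V = 0) :
    polarRetraction α V U ∈ stiefel d N α ∧
      ‖polarRetraction α V U - (V + U)‖ ≤ √(α * N) / α * ‖U‖ ^ 2 := by
  obtain ⟨P, hP, hPP, hR⟩ := exists_polarRetraction_eq hα V U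
  have hs : √α * √α = α := Real.mul_self_sqrt hα.le
  have hs0 : 0 < √α := Real.sqrt_pos.mpr hα
  have hPt : Pᵀ = P := by simpa using hP.isHermitian.eq
  have hgram : (V + U)ᵀ * (V + U) = P * P := by
    have hV' : Vᵀ * V = α • 1 := hV
    rw [hPP, Matrix.transpose_add, Matrix.add_mul, Matrix.mul_add, Matrix.mul_add, hV']
    linear_combination (norm := abel) hU
  have hPu : IsUnit P.det := by
    have hpd : (P * P).PosDef := by
      rw [hPP]
      exact (Matrix.PosDef.one.smul hα).add_posSemidef (gram_posSemidef U)
    have := hpd.det_pos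
    rw [Matrix.det_mul] at this
    exact (left_ne_zero_of_mul this.ne').isUnit
  have hPit : (P⁻¹)ᵀ = P⁻¹ := by rw [Matrix.transpose_nonsing_inv, hPt]
  have hmem : polarRetraction α V U ∈ stiefel d N α := by
    change (polarRetraction α V U)ᵀ * polarRetraction α V U = _
    rw [hR, Matrix.transpose_smul, Matrix.smul_mul, Matrix.mul_smul, smul_smul, hs,
      Matrix.transpose_mul, hPit, Matrix.mul_assoc, ← Matrix.mul_assoc _ _ P⁻¹, hgram,
      Matrix.mul_assoc P, Matrix.mul_nonsing_inv _ hPu, mul_one, Matrix.nonsing_inv_mul _ hPu]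
  refine ⟨hmem, ?_⟩
  set X := P - √α • (1 : Matrix (Fin N) (Fin N) ℝ) with hX
  have hXt : Xᵀ = X := by simp [hX, hPt]
  -- Here `UᵀU = P² - αI = XP + √α X`, and the cross term `tr (X P X)` is nonnegative, so `‖UᵀU‖`
  -- dominates `√α ‖X‖`.
  have hXbound : √α * ‖X‖ ≤ ‖U‖ ^ 2 := by
    have hUX : Uᵀ * U = X * P + √α • X := by
      have : Uᵀ * U = P * P - α • 1 := by rw [hPP]; abel
      rw [this, hX, Matrix.sub_mul, smul_sub, smul_smul, hs, Matrix.smul_mul, one_mul]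
      abel
    have hcross : 0 ≤ ((X * P)ᵀ * X).trace := by
      have h1 : (X * P * X).PosSemidef := by
        simpa [hXt] using hP.mul_mul_conjTranspose_same X
      have h2 : ((X * P)ᵀ * X).trace = (X * P * X).trace := by
        rw [Matrix.transpose_mul, hXt, hPt, Matrix.mul_assoc, Matrix.trace_mul_comm,
          Matrix.mul_assoc, Matrix.trace_mul_comm]
      rw [h2]
      exact h1.trace_nonneg
    have hsq : (√α * ‖X‖) ^ 2 ≤ ‖Uᵀ * U‖ ^ 2 := by
      have h1 : ‖Uᵀ * U‖ ^ 2 =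
          ‖X * P‖ ^ 2 + 2 * √α * ((X * P)ᵀ * X).trace + (√α) ^ 2 * ‖X‖ ^ 2 := by
        have h2 : (Xᵀ * (X * P)).trace = ((X * P)ᵀ * X).trace := by
          rw [← Matrix.trace_transpose]; simp
        rw [hUX, frobenius_norm_sq, frobenius_norm_sq, frobenius_norm_sq, Matrix.transpose_add,
          Matrix.add_mul, Matrix.mul_add, Matrix.mul_add, Matrix.transpose_smul]
        simp only [Matrix.smul_mul, Matrix.mul_smul, Matrix.trace_add, Matrix.trace_smul,
          smul_eq_mul, h2]
        ring
      rw [h1, mul_pow]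
      have := mul_nonneg hs0.le hcross
      nlinarith [sq_nonneg ‖X * P‖]
    calc √α * ‖X‖ ≤ ‖Uᵀ * U‖ := by
          exact (sq_le_sq₀ (by positivity) (norm_nonneg _)).mp hsq
      _ ≤ ‖Uᵀ‖ * ‖U‖ := Matrix.frobenius_norm_mul _ _
      _ = ‖U‖ ^ 2 := by rw [Matrix.frobenius_norm_transpose, sq]
  -- With `R` the retracted point, `RP = √α (V + U)`: the retraction error is `R` times the
  -- deviation `X` of `P` from `√α I`.
  have hdiff : √α • (polarRetraction α V U - (V + U)) = -(polarRetraction α V U * X) := by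
    have h1 : polarRetraction α V U * P = √α • (V + U) := by
      rw [hR, Matrix.smul_mul, Matrix.mul_assoc, Matrix.nonsing_inv_mul _ hPu, Matrix.mul_one]
    rw [hX, Matrix.mul_sub, h1, Matrix.mul_smul, Matrix.mul_one]
    module
  have hn : √α * ‖polarRetraction α V U - (V + U)‖ ≤ √(α * N) * ‖X‖ := by
    rw [← norm_of_mem_stiefel hmem]
    calc _ = ‖√α • (polarRetraction α V U - (V + U))‖ := by
          rw [norm_smul, Real.norm_of_nonneg hs0.le]
      _ = ‖polarRetraction α V U * X‖ := by rw [hdiff, norm_neg]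
      _ ≤ _ := Matrix.frobenius_norm_mul _ _
  rw [div_mul_eq_mul_div, le_div_iff₀ hα]
  calc ‖polarRetraction α V U - (V + U)‖ * α
      = √α * (√α * ‖polarRetraction α V U - (V + U)‖) := by rw [← mul_assoc, hs]; ring
    _ ≤ √α * (√(α * N) * ‖X‖) := by gcongr
    _ = √(α * N) * (√α * ‖X‖) := by ring
    _ ≤ _ := by gcongr

/-! ### Uniform descent and gradient bounds -/

theorem norm_gram_le {d N : ℕ} {α : ℝ} (H : Matrix (Fin d) (Fin N) ℝ)
    {V : Matrix (Fin d) (Fin N) ℝ} (hV : V ∈ stiefel d N α) :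
    ‖(H + V)ᵀ * (H + V)‖ ≤ (‖H‖ + √(α * N)) ^ 2 := by
  have h : ‖H + V‖ ≤ ‖H‖ + √(α * N) := by
    rw [← norm_of_mem_stiefel hV]; exact norm_add_le _ _
  calc _ ≤ ‖(H + V)ᵀ‖ * ‖H + V‖ := Matrix.frobenius_norm_mul _ _
    _ = ‖H + V‖ ^ 2 := by rw [Matrix.frobenius_norm_transpose, sq]
    _ ≤ _ := by gcongr

/-- Uniform second-order decrease of the objective along the polar retraction. -/
theorem exists_descent {d N : ℕ} {α : ℝ} (hα : 0 < α) (H : Matrix (Fin d) (Fin N) ℝ) {δ : ℝ}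
    (hδ : 0 < δ) :
    ∃ L r : ℝ, 0 < L ∧ 0 < r ∧ ∀ V ∈ stiefel d N α, δ ≤ ((H + V)ᵀ * (H + V)).det →
      ∀ U : Matrix (Fin d) (Fin N) ℝ, Vᵀ * U + Uᵀ * V = 0 → ‖U‖ ≤ r →
        polarRetraction α V U ∈ stiefel d N α ∧
        0 < ((H + polarRetraction α V U)ᵀ * (H + polarRetraction α V U)).det ∧
        -Real.log ((H + polarRetraction α V U)ᵀ * (H + polarRetraction α V U)).det ≤
          -Real.log ((H + V)ᵀ * (H + V)).det + ((euclideanGrad H V)ᵀ * U).trace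
            + L * ‖U‖ ^ 2 := by
  obtain ⟨B, hB0, hB⟩ := exists_norm_inv_le N ((‖H‖ + √(α * N)) ^ 2) δ hδ
  set κ := √(α * N) / α
  have hκ : 0 ≤ κ := by positivity
  set e := 2 * ‖H‖ * (1 + κ)
  have he : 0 ≤ e := by positivity
  -- In `L`, the first term pays for the retraction error and the second for the curvature of `-log
  -- det`. The radius ensures `‖U‖² ≤ ‖U‖` and a Gram perturbation, at most `e ‖U‖`, small enough
  -- for `neg_log_det_add_le`; `e + 1` guards against `e = 0`.
  refine ⟨2 * N * B * ‖H‖ * κ + 2 * N * B ^ 2 * e ^ 2 + 1, min 1 (1 / (2 * B * (e + 1))),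
    by positivity, by positivity, fun V hV hdet U hU hUr => ?_⟩
  obtain ⟨hmem, hW⟩ := polarRetraction_spec hα hV hU
  set R := polarRetraction α V U
  refine ⟨hmem, ?_⟩
  have hU1 : ‖U‖ ≤ 1 := hUr.trans (min_le_left _ _)
  have hU2 : ‖U‖ ≤ 1 / (2 * B * (e + 1)) := hUr.trans (min_le_right _ _)
  set G := (H + V)ᵀ * (H + V)
  have hinv : ‖G⁻¹‖ ≤ B := hB G (norm_gram_le H hV) hdet
  have hRV : ‖R - V‖ ≤ (1 + κ) * ‖U‖ := by
    have h1 : R - V = U + (R - (V + U)) := by abel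
    rw [h1]
    refine (norm_add_le _ _).trans ?_
    nlinarith [mul_nonneg hκ (norm_nonneg U), norm_nonneg U]
  have hE : ‖Hᵀ * (R - V) + (R - V)ᵀ * H‖ ≤ e * ‖U‖ := by
    calc _ ≤ ‖Hᵀ * (R - V)‖ + ‖(R - V)ᵀ * H‖ := norm_add_le _ _
      _ ≤ ‖Hᵀ‖ * ‖R - V‖ + ‖(R - V)ᵀ‖ * ‖H‖ :=
        add_le_add (Matrix.frobenius_norm_mul _ _) (Matrix.frobenius_norm_mul _ _)
      _ = 2 * ‖H‖ * ‖R - V‖ := by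
        rw [Matrix.frobenius_norm_transpose, Matrix.frobenius_norm_transpose]; ring
      _ ≤ 2 * ‖H‖ * ((1 + κ) * ‖U‖) := by gcongr
      _ = _ := by ring
  have hBE : B * ‖Hᵀ * (R - V) + (R - V)ᵀ * H‖ ≤ 1 / 2 := by
    calc _ ≤ B * ((e + 1) * (1 / (2 * B * (e + 1)))) := by
          gcongr
          refine hE.trans ?_
          gcongr
          linarith
      _ = 1 / 2 := by field_simp
  have hgram := gram_eq_add H hV hmem
  have hps := gram_posSemidef (H + R)
  rw [hgram] at hps ⊢
  obtain ⟨hpos, hle⟩ :=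
    neg_log_det_add_le (gram_posSemidef (H + V)) (hδ.trans_le hdet) hps hinv hBE
  refine ⟨hpos, hle.trans ?_⟩
  have htr : (G⁻¹ * (Hᵀ * (R - V) + (R - V)ᵀ * H)).trace =
      -((euclideanGrad H V)ᵀ * U).trace + 2 * (G⁻¹ * (Hᵀ * (R - (V + U)))).trace := by
    have h1 : R - V = U + (R - (V + U)) := by abel
    rw [trace_mul_symm_part (gram_inv_transpose _), trace_euclideanGrad_mul H hU]
    nth_rewrite 1 [h1]
    rw [Matrix.mul_add Hᵀ, Matrix.mul_add _ (Hᵀ * U), Matrix.trace_add]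
    ring
  have hrem : -(G⁻¹ * (Hᵀ * (R - (V + U)))).trace ≤ N * B * ‖H‖ * κ * ‖U‖ ^ 2 := by
    calc _ ≤ N * ‖G⁻¹ * (Hᵀ * (R - (V + U)))‖ := (neg_le_abs _).trans (abs_trace_le _)
      _ ≤ N * (‖G⁻¹‖ * (‖Hᵀ‖ * ‖R - (V + U)‖)) := by
        gcongr
        refine (Matrix.frobenius_norm_mul _ _).trans ?_
        gcongr
        exact Matrix.frobenius_norm_mul _ _
      _ ≤ N * (B * (‖H‖ * (κ * ‖U‖ ^ 2))) := by
        rw [Matrix.frobenius_norm_transpose]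
        gcongr
      _ = _ := by ring
  have hquad : 2 * N * B ^ 2 * ‖Hᵀ * (R - V) + (R - V)ᵀ * H‖ ^ 2 ≤
      2 * N * B ^ 2 * (e * ‖U‖) ^ 2 := by gcongr
  rw [htr]
  nlinarith [sq_nonneg ‖U‖]

/-- The Riemannian gradient is bounded where the Gram determinant is bounded below. -/
theorem exists_norm_riemannianGrad_le {d N : ℕ} {α : ℝ} (hα : 0 < α)
    (H : Matrix (Fin d) (Fin N) ℝ) {δ : ℝ} (hδ : 0 < δ) :
    ∃ D : ℝ, 0 < D ∧ ∀ V ∈ stiefel d N α, δ ≤ ((H + V)ᵀ * (H + V)).det →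
      ‖riemannianGrad H α V‖ ≤ D := by
  obtain ⟨B, hB0, hB⟩ := exists_norm_inv_le N ((‖H‖ + √(α * N)) ^ 2) δ hδ
  set v := √(α * N)
  set g := 2 * ((‖H‖ + v) * B)
  refine ⟨g + 1 / (2 * α) * (v * (v * g + g * v)) + 1, by positivity, fun V hV hdet => ?_⟩
  have hv : ‖V‖ = v := norm_of_mem_stiefel hV
  have hg : ‖euclideanGrad H V‖ ≤ g := by
    rw [euclideanGrad, norm_smul]
    have h1 : ‖H + V‖ ≤ ‖H‖ + v := by rw [← hv]; exact norm_add_le _ _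
    have h2 := hB _ (norm_gram_le H hV) hdet
    calc _ ≤ ‖(-2 : ℝ)‖ * (‖H + V‖ * ‖((H + V)ᵀ * (H + V))⁻¹‖) := by
          gcongr; exact Matrix.frobenius_norm_mul _ _
      _ ≤ ‖(-2 : ℝ)‖ * ((‖H‖ + v) * B) := by gcongr
      _ = g := by simp [g]
  have hM : ‖V * (Vᵀ * euclideanGrad H V + (euclideanGrad H V)ᵀ * V)‖ ≤
      v * (v * g + g * v) := by
    calc _ ≤ ‖V‖ * (‖Vᵀ‖ * ‖euclideanGrad H V‖ + ‖(euclideanGrad H V)ᵀ‖ * ‖V‖) := by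
          refine (Matrix.frobenius_norm_mul _ _).trans ?_
          gcongr
          refine (norm_add_le _ _).trans ?_
          exact add_le_add (Matrix.frobenius_norm_mul _ _) (Matrix.frobenius_norm_mul _ _)
      _ ≤ _ := by
          rw [Matrix.frobenius_norm_transpose, Matrix.frobenius_norm_transpose, hv]
          gcongr
  rw [riemannianGrad, tangentProj]
  calc _ ≤ ‖euclideanGrad H V‖ +
        ‖(1 / (2 * α)) • (V * (Vᵀ * euclideanGrad H V + (euclideanGrad H V)ᵀ * V))‖ :=
        norm_sub_le _ _
    _ ≤ g + 1 / (2 * α) * (v * (v * g + g * v)) := by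
        rw [norm_smul, Real.norm_of_nonneg (by positivity)]
        gcongr
    _ ≤ _ := by linarith

end ScaledStiefel

/-! ### Initialization, line search and telescoping -/

namespace ScaledStiefel

theorem init_orthonormal {d N : ℕ} {H : Matrix (Fin d) (Fin N) ℝ} {α : ℝ} (hα : 0 < α)
    {V₀ : Matrix (Fin d) (Fin N) ℝ} (h : IsInitialization H α V₀) :
    V₀ ∈ stiefel d N α ∧ V₀ᵀ * H = 0 := by
  obtain ⟨Q, σ, W, hsvd, s, hs, hrank, rfl⟩ := h
  have hQ : Qᵀ * Q = 1 := by
    simpa [Matrix.star_eq_conjTranspose] using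
      Matrix.mem_unitaryGroup_iff'.mp hsvd.left_orthogonal
  constructor
  · change (√α • Q.submatrix id s)ᵀ * (√α • Q.submatrix id s) = _
    rw [Matrix.transpose_smul, Matrix.smul_mul, Matrix.mul_smul, smul_smul,
      Real.mul_self_sqrt hα.le, Matrix.transpose_submatrix,
      ← Matrix.submatrix_mul _ _ s id s Function.bijective_id, hQ, Matrix.submatrix_one _ hs]
  · rw [hsvd.eq_mul, Matrix.transpose_smul, Matrix.smul_mul, ← Matrix.mul_assoc,
      ← Matrix.mul_assoc, Matrix.transpose_submatrix]
    have h1 : Qᵀ.submatrix s id * Q = (1 : Matrix (Fin d) (Fin d) ℝ).submatrix s id := by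
      rw [← hQ]
      exact (Matrix.submatrix_mul Qᵀ Q s id id Function.bijective_id).symm
    -- The selected rows of `Σ` have index at least `rank H`, where no positive singular value sits.
    have h2 : (1 : Matrix (Fin d) (Fin d) ℝ).submatrix s id *
        (Matrix.of fun (i : Fin d) (j : Fin N) => if (i : ℕ) = (j : ℕ) then σ j else 0) = 0 := by
      ext i j
      simp only [Matrix.mul_apply, Matrix.submatrix_apply, Matrix.one_apply, id, Matrix.of_apply,
        ite_mul, one_mul, zero_mul, Finset.sum_ite_eq, Finset.mem_univ, if_true,
        Matrix.zero_apply]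
      split_ifs with hij
      · refine le_antisymm (not_lt.mp fun hpos => ?_) (hsvd.nonneg j)
        have := (hsvd.pos_iff j).mp hpos
        have := hrank i
        omega
      · rfl
    rw [h1, h2]
    simp

theorem gram_of_orthogonal {d N : ℕ} {H V : Matrix (Fin d) (Fin N) ℝ} {α : ℝ}
    (hV : V ∈ stiefel d N α) (h : Vᵀ * H = 0) :
    (H + V)ᵀ * (H + V) = Hᵀ * H + α • 1 := by
  have h' : Hᵀ * V = 0 := by
    have := congrArg Matrix.transpose h
    simpa using this
  rw [gram_eq H hV, h, h']
  simp

theorem objective_of_pos {d N : ℕ} {H V : Matrix (Fin d) (Fin N) ℝ}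
    (h : 0 < ((H + V)ᵀ * (H + V)).det) :
    objective H V = ((-Real.log ((H + V)ᵀ * (H + V)).det : ℝ) : EReal) := if_pos h

theorem trialPoint_mem {d N : ℕ} {α : ℝ} (hα : 0 < α) (H : Matrix (Fin d) (Fin N) ℝ)
    {V : Matrix (Fin d) (Fin N) ℝ} (hV : V ∈ stiefel d N α) (η : ℝ) :
    trialPoint H α V η ∈ stiefel d N α := by
  refine (polarRetraction_spec hα hV ?_).1
  have h := riemannianGrad_tangent hα H hV
  have : Vᵀ * (η • -riemannianGrad H α V) + (η • -riemannianGrad H α V)ᵀ * V =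
      (-η) • (Vᵀ * riemannianGrad H α V + (riemannianGrad H α V)ᵀ * V) := by
    simp only [Matrix.mul_smul, Matrix.mul_neg, Matrix.transpose_smul, Matrix.transpose_neg,
      Matrix.smul_mul, Matrix.neg_mul]
    module
  rw [this, h, smul_zero]

theorem armijo_iff {d N : ℕ} {H V : Matrix (Fin d) (Fin N) ℝ} {α c η : ℝ}
    (h : 0 < ((H + V)ᵀ * (H + V)).det) :
    Armijo H α c V η ↔
      0 < ((H + trialPoint H α V η)ᵀ * (H + trialPoint H α V η)).det ∧
      c * η * ‖riemannianGrad H α V‖ ^ 2 ≤ -Real.log ((H + V)ᵀ * (H + V)).det -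
        -Real.log ((H + trialPoint H α V η)ᵀ * (H + trialPoint H α V η)).det := by
  rw [Armijo, objective_of_pos h, norm_neg]
  by_cases hR : 0 < ((H + trialPoint H α V η)ᵀ * (H + trialPoint H α V η)).det
  · rw [objective_of_pos hR, ← EReal.coe_sub, EReal.coe_le_coe_iff]
    exact ⟨fun h => ⟨hR, h⟩, fun h => h.2⟩
  · rw [objective, if_neg hR, EReal.sub_top, le_bot_iff]
    exact ⟨fun h => absurd h (EReal.coe_ne_bot _), fun h => absurd h.1 hR⟩

/-- Every sufficiently small stepsize passes the Armijo test, uniformly over points of the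
manifold whose Gram determinant is bounded below. -/
theorem exists_armijo_of_le {d N : ℕ} {α : ℝ} (hα : 0 < α) (H : Matrix (Fin d) (Fin N) ℝ)
    {δ c : ℝ} (hδ : 0 < δ) (hc : c < 1) :
    ∃ t : ℝ, 0 < t ∧ ∀ V ∈ stiefel d N α, δ ≤ ((H + V)ᵀ * (H + V)).det →
      ∀ η, 0 < η → η ≤ t → Armijo H α c V η := by
  obtain ⟨L, r, hL, hr, hdesc⟩ := exists_descent hα H hδ
  obtain ⟨D, hD, hgrad⟩ := exists_norm_riemannianGrad_le hα H hδ
  have hc' : 0 < 1 - c := by linarith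
  -- The first bound keeps the step within the descent radius; the second makes the guaranteed
  -- decrease `η (1 - ηL) ‖S‖²` at least `c η ‖S‖²`.
  refine ⟨min (r / D) ((1 - c) / L), by positivity, fun V hV hdet η hη hηt => ?_⟩
  have h1 : η * D ≤ r := (le_div_iff₀ hD).mp (hηt.trans (min_le_left _ _))
  have h2 : η * L ≤ 1 - c := (le_div_iff₀ hL).mp (hηt.trans (min_le_right _ _))
  set S := riemannianGrad H α V with hS
  have htan : Vᵀ * (η • -S) + (η • -S)ᵀ * V = 0 := by
    have : Vᵀ * (η • -S) + (η • -S)ᵀ * V = (-η) • (Vᵀ * S + Sᵀ * V) := by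
      simp only [Matrix.mul_smul, Matrix.mul_neg, Matrix.transpose_smul, Matrix.transpose_neg,
        Matrix.smul_mul, Matrix.neg_mul]
      module
    rw [this, riemannianGrad_tangent hα H hV, smul_zero]
  have hn : ‖η • -S‖ = η * ‖S‖ := by rw [norm_smul, norm_neg, Real.norm_of_nonneg hη.le]
  have hnr : ‖η • -S‖ ≤ r := by
    rw [hn]
    exact le_trans (by gcongr; exact hgrad V hV hdet) h1
  obtain ⟨-, hpos, hle⟩ := hdesc V hV hdet _ htan hnr
  rw [armijo_iff (hδ.trans_le hdet)]
  refine ⟨hpos, ?_⟩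
  have htr : ((euclideanGrad H V)ᵀ * (η • -S)).trace = -η * ‖S‖ ^ 2 := by
    rw [norm_riemannianGrad_sq hα H hV, Matrix.mul_smul, Matrix.mul_neg, Matrix.trace_smul,
      Matrix.trace_neg, smul_eq_mul]
    ring
  rw [htr, hn] at hle
  change c * η * ‖S‖ ^ 2 ≤ _ - -Real.log ((H + polarRetraction α V (η • -S))ᵀ *
    (H + polarRetraction α V (η • -S))).det
  have h3 : (η * L) * (η * ‖S‖ ^ 2) ≤ (1 - c) * (η * ‖S‖ ^ 2) := by gcongr
  nlinarith

theorem IsLineSearchStep.decrease {d N : ℕ} {H V V' : Matrix (Fin d) (Fin N) ℝ}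
    {α ρ c ηbar t δ : ℝ} (hα : 0 < α) (hρ₀ : 0 < ρ) (hc₀ : 0 < c) (hη : 0 < ηbar) (hδ : 0 < δ)
    (ht : ∀ η, 0 < η → η ≤ t → Armijo H α c V η)
    (hV : V ∈ stiefel d N α) (hdet : δ ≤ ((H + V)ᵀ * (H + V)).det)
    (h : IsLineSearchStep H α ρ c ηbar V V') :
    V' ∈ stiefel d N α ∧ δ ≤ ((H + V')ᵀ * (H + V')).det ∧
      c * min ηbar (ρ * t) * ‖riemannianGrad H α V‖ ^ 2 ≤
        -Real.log ((H + V)ᵀ * (H + V)).det - -Real.log ((H + V')ᵀ * (H + V')).det := by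
  obtain ⟨j, hj, hfirst, rfl⟩ := h
  have hpos := hδ.trans_le hdet
  rw [armijo_iff hpos] at hj
  obtain ⟨hpos', hle⟩ := hj
  have hlog : Real.log ((H + V)ᵀ * (H + V)).det ≤ Real.log
      ((H + trialPoint H α V (ηbar * ρ ^ j))ᵀ * (H + trialPoint H α V (ηbar * ρ ^ j))).det := by
    have : 0 ≤ c * (ηbar * ρ ^ j) * ‖riemannianGrad H α V‖ ^ 2 := by positivity
    linarith
  refine ⟨trialPoint_mem hα H hV _, hdet.trans ((Real.log_le_log_iff hpos hpos').mp hlog),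
    le_trans ?_ hle⟩
  -- Either the initial stepsize is accepted, or the preceding trial failed and so exceeded `t`.
  have hstep : min ηbar (ρ * t) ≤ ηbar * ρ ^ j := by
    rcases j with _ | j
    · simp
    · have hlt : t < ηbar * ρ ^ j := by
        by_contra! hcon
        exact hfirst j (Nat.lt_succ_self j) (ht _ (by positivity) hcon)
      refine (min_le_right _ _).trans ?_
      rw [pow_succ]
      nlinarith
  gcongr

theorem exists_isLineSearchStep {d N : ℕ} {H V : Matrix (Fin d) (Fin N) ℝ} {α ρ c ηbar t : ℝ}
    (hρ₀ : 0 < ρ) (hρ₁ : ρ < 1) (hη : 0 < ηbar) (ht₀ : 0 < t)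
    (ht : ∀ η, 0 < η → η ≤ t → Armijo H α c V η) :
    ∃ V', IsLineSearchStep H α ρ c ηbar V V' := by
  classical
  have hex : ∃ j : ℕ, Armijo H α c V (ηbar * ρ ^ j) := by
    obtain ⟨j, hj⟩ := exists_pow_lt_of_lt_one (show 0 < t / ηbar by positivity) hρ₁
    refine ⟨j, ht _ (by positivity) ?_⟩
    rw [mul_comm]
    exact ((lt_div_iff₀ hη).mp hj).le
  exact ⟨_, Nat.find hex, Nat.find_spec hex, fun i hi => Nat.find_min hex hi, rfl⟩

theorem neg_log_det_gram_ge {d N : ℕ} {α : ℝ} (H : Matrix (Fin d) (Fin N) ℝ)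
    {V : Matrix (Fin d) (Fin N) ℝ} (hV : V ∈ stiefel d N α)
    (hpos : 0 < ((H + V)ᵀ * (H + V)).det) :
    -(‖H‖ + √(α * N)) ^ 2 ≤ -Real.log ((H + V)ᵀ * (H + V)).det := by
  have h1 := log_det_le_trace_sub (gram_posSemidef (H + V)) hpos
  rw [← frobenius_norm_sq] at h1
  have h2 : ‖H + V‖ ≤ ‖H‖ + √(α * N) := by
    rw [← norm_of_mem_stiefel hV]; exact norm_add_le _ _
  have h3 : ‖H + V‖ ^ 2 ≤ (‖H‖ + √(α * N)) ^ 2 := by gcongr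
  have : (0 : ℝ) ≤ N := by positivity
  linarith

theorem inf'_range_le_of_telescoping {a f : ℕ → ℝ} {b m : ℝ} (hb : 0 < b)
    (hstep : ∀ k, b * a k ≤ f k - f (k + 1)) (hm : ∀ k, m ≤ f k) (K : ℕ) (hK : 1 ≤ K) :
    (Finset.range (K + 1)).inf' Finset.nonempty_range_add_one a ≤
      ((f 0 - m) / b) / (K : ℝ) := by
  have hK' : (0 : ℝ) < K := by exact_mod_cast hK
  set μ := (Finset.range (K + 1)).inf' Finset.nonempty_range_add_one a with hμ
  have hle (k : ℕ) (hk : k ∈ Finset.range (K + 1)) : μ ≤ a k := Finset.inf'_le a hk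
  have hsum : ∑ k ∈ Finset.range K, b * μ ≤ f 0 - f K := by
    rw [← Finset.sum_range_sub']
    refine Finset.sum_le_sum fun k hk => le_trans ?_ (hstep k)
    gcongr
    exact hle k (Finset.mem_range.mpr ((Finset.mem_range.mp hk).trans (Nat.lt_succ_self K)))
  rw [Finset.sum_const, Finset.card_range, nsmul_eq_mul] at hsum
  have := hm K
  rw [le_div_iff₀ hK', le_div_iff₀ hb]
  linarith

end ScaledStiefel

/-! ### The main theorem -/

theorem theorem1 {d N : ℕ} (H : Matrix (Fin d) (Fin N) ℝ) (α ρ c ηbar : ℝ)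
    (hα : 0 < α) (hρ₀ : 0 < ρ) (hρ₁ : ρ < 1) (hc₀ : 0 < c) (hc₁ : c < 1) (hη : 0 < ηbar) :
    (∀ V₀ : Matrix (Fin d) (Fin N) ℝ, ScaledStiefel.IsInitialization H α V₀ →
      ηbar < √α / ScaledStiefel.gradBound H α V₀ →
      ∃ V : ℕ → Matrix (Fin d) (Fin N) ℝ,
        V 0 = V₀ ∧ ScaledStiefel.IsRGDSequence H α ρ c ηbar V) ∧
    ∃ M : ℝ, ∀ V : ℕ → Matrix (Fin d) (Fin N) ℝ,
      ScaledStiefel.IsRGDSequence H α ρ c ηbar V →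
      ηbar < √α / ScaledStiefel.gradBound H α (V 0) →
      ∀ K : ℕ, 1 ≤ K →
        (Finset.range (K + 1)).inf' Finset.nonempty_range_add_one
          (fun k => ‖ScaledStiefel.riemannianGrad H α (V k)‖ ^ 2) ≤ M / (K : ℝ) := by
  open ScaledStiefel in
  set δ := (Hᵀ * H + α • (1 : Matrix (Fin N) (Fin N) ℝ)).det with hδdef
  have hδ : 0 < δ :=
    (add_comm (Hᵀ * H) _ ▸
      (Matrix.PosDef.one.smul hα).add_posSemidef (gram_posSemidef H)).det_pos
  obtain ⟨t, ht₀, ht⟩ := exists_armijo_of_le hα H hδ hc₁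
  have hinit (V₀) (h : IsInitialization H α V₀) :
      V₀ ∈ stiefel d N α ∧ ((H + V₀)ᵀ * (H + V₀)).det = δ := by
    obtain ⟨h1, h2⟩ := init_orthonormal hα h
    exact ⟨h1, by rw [gram_of_orthogonal h1 h2]⟩
  constructor
  · intro V₀ h₀ _
    -- Bundling the invariants with the point allows the step map to be iterated.
    have hnext (V : {V // V ∈ stiefel d N α ∧ δ ≤ ((H + V)ᵀ * (H + V)).det}) :
        ∃ V' : {V // V ∈ stiefel d N α ∧ δ ≤ ((H + V)ᵀ * (H + V)).det},
          IsLineSearchStep H α ρ c ηbar V.1 V'.1 := by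
      obtain ⟨V', hV'⟩ := exists_isLineSearchStep hρ₀ hρ₁ hη ht₀ (ht V.1 V.2.1 V.2.2)
      obtain ⟨h1, h2, -⟩ :=
        hV'.decrease hα hρ₀ hc₀ hη hδ (ht V.1 V.2.1 V.2.2) V.2.1 V.2.2
      exact ⟨⟨V', h1, h2⟩, hV'⟩
    choose next hnext using hnext
    obtain ⟨h1, h2⟩ := hinit V₀ h₀
    refine ⟨fun k => (next^[k] ⟨V₀, h1, h2.ge⟩).1, rfl, h₀, fun k => ?_⟩
    simp only [Function.iterate_succ_apply']
    exact hnext _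
  · refine ⟨(-Real.log δ - -(‖H‖ + √(α * N)) ^ 2) / (c * min ηbar (ρ * t)),
      fun V hV _ K hK => ?_⟩
    obtain ⟨h1, h2⟩ := hinit _ hV.init
    have hgood (k) : V k ∈ stiefel d N α ∧ δ ≤ ((H + V k)ᵀ * (H + V k)).det := by
      induction k with
      | zero => exact ⟨h1, h2.ge⟩
      | succ k ih =>
        obtain ⟨h3, h4, -⟩ := (hV.step k).decrease hα hρ₀ hc₀ hη hδ (ht _ ih.1 ih.2) ih.1 ih.2
        exact ⟨h3, h4⟩
    have h := inf'_range_le_of_telescoping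
      (a := fun k => ‖riemannianGrad H α (V k)‖ ^ 2)
      (f := fun k => -Real.log ((H + V k)ᵀ * (H + V k)).det)
      (b := c * min ηbar (ρ * t)) (by positivity)
      (fun k => ((hV.step k).decrease hα hρ₀ hc₀ hη hδ (ht _ (hgood k).1 (hgood k).2)
        (hgood k).1 (hgood k).2).2.2)
      (fun k => neg_log_det_gram_ge H (hgood k).1 (hδ.trans_le (hgood k).2)) K hK
    simpa only [h2] using h
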